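/- Let $G$ be a Carnot group of step $s\ge 1$, i.e. a connected and simply connected Lie group whose Lie algebra is endowed with a stratification $\mathfrak g=V_1\oplus\cdots\oplus V_s$, where $[V_1,V_j]=V_{j+1}$ for $1\le j\le s-1$, $[V_1,V_s]=\{0\}$ and $V_s\neq\{0\}$. Let $n=\dim\mathfrak g$ and assume that $n\ge 2$ (which only excludes $G=\mathbb R$). Let $m_1=\dim V_1$, let $(X_1,\dots,X_n)$ be a basis of $\mathfrak g$ adapted to the stratification (a basis of $V_1$ followed by a basis of $V_2$, and so on), and let $\alpha_i$ be the index of the layer containing $X_i$. Identify $G$ with $\mathbb R^n$ through $(x_1,\dots,x_n)\mapsto \exp(x_1X_1+\cdots+x_nX_n)$, and set $\delta_\lambda(x_1,\dots,x_n)=(\lambda^{\alpha_1}x_1,\dots,\lambda^{\alpha_n}x_n)$ for $\lambda>0$. Let $d:G\times G\to[0,\infty)$ be a homogeneous quasi-distance: $d$ is symmetric, $d(p,q)=0$ if and only if $p=q$, there is $C\ge1$ with $d(p,q)\le C(d(p,p')+d(p',q))$ for all $p,p',q\in G$, $d(p\cdot q,p\cdot q')=d(q,q')$ for all $p,q,q'\in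 G$, and $d(\delta_\lambda(p),\delta_\lambda(q))=\lambda\, d(p,q)$ for all $p,q\in G$ and $\lambda>0$. Write $B_d(p,r)=\{q\in G: d(q,p)\le r\}$ for $p\in G$, $r>0$; these sets are called balls. Assume that, for some $c_i>0$ and $\gamma_i>0$, $$B_d(0,1)=\{(x_1,\dots,x_n)\in G:\ c_1|x_1|^{\gamma_1}+\cdots+c_n|x_n|^{\gamma_n}\le 1\}.$$ Assume that $(G,d)$ satisfies the Besicovitch Covering Property (BCP): there is $N\in\mathbb N$ such that for every bounded set $A\subset G$ and every family $\mathcal B$ of balls such that each point of $A$ is the center of some ball of $\mathcal B$, there is a finite or countable subfamily $\mathcal F\subset\mathcal B$ whose balls cover $A$ and such that every point of $G$ belongs to at most $N$ balls of $\mathcal F$. Then $$\min(\gamma_1,\dots,\gamma_{m_1})\ge s.$$ -/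

import Mathlib

open scoped Manifold ContDiff

noncomputable section

/-! ### Quasi-metric spaces and the Besicovitch Covering Property -/

/-- `d` is a quasi-distance on `X`. -/
structure IsQuasiDist {X : Type*} (d : X → X → ℝ) : Prop where
  nonneg : ∀ p q, 0 ≤ d p q
  symm : ∀ p q, d p q = d q p
  eq_zero_iff : ∀ p q, d p q = 0 ↔ p = q
  quasi_triangle : ∃ C : ℝ, 1 ≤ C ∧ ∀ p p' q, d p q ≤ C * (d p p' + d p' q)

/-- The closed ball `B_d(p, r) = {q | d(q, p) ≤ r}`. -/
def qBall {X : Type*} (d : X → X → ℝ) (p : X) (r : ℝ) : Set X :=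
  {q | d q p ≤ r}

/-- The Besicovitch Covering Property of `(X, d)`. Balls are sets of the form `B_d(p, r)`, `r > 0`;
a family of balls is a set of such sets, and multiplicities are counted in `ℕ∞`. -/
def SatisfiesBCP {X : Type*} (d : X → X → ℝ) : Prop :=
  ∃ N : ℕ, ∀ (A : Set X) (𝓑 : Set (Set X)),
    (∃ R : ℝ, ∀ a ∈ A, ∀ b ∈ A, d a b ≤ R) →
    (∀ B ∈ 𝓑, ∃ p : X, ∃ r : ℝ, 0 < r ∧ B = qBall d p r) →
    (∀ a ∈ A, ∃ r : ℝ, 0 < r ∧ qBall d a r ∈ 𝓑) →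
    ∃ 𝓕 : Set (Set X), 𝓕 ⊆ 𝓑 ∧ 𝓕.Countable ∧ A ⊆ ⋃₀ 𝓕 ∧
      ∀ x : X, {B ∈ 𝓕 | x ∈ B}.encard ≤ N

/-! ### Carnot groups

A Carnot group of step `s` is a connected and simply connected Lie group together with a
stratification `V₁ ⊕ ⋯ ⊕ V_s` of its Lie algebra. -/

section Carnot

variable {E : Type*} [NormedAddCommGroup E] [NormedSpace ℝ E]
  {G : Type*} [TopologicalSpace G] [ChartedSpace E G] [Group G]

/-- The subspace `[U, W]` of the Lie algebra spanned by the brackets `[u, w]`,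
`u ∈ U`, `w ∈ W`. -/
def bracketSpan (U W : Submodule ℝ (GroupLieAlgebra 𝓘(ℝ, E) G)) :
    Submodule ℝ (GroupLieAlgebra 𝓘(ℝ, E) G) :=
  Submodule.span ℝ {z | ∃ u ∈ U, ∃ w ∈ W, z = ⁅u, w⁆}

/-- `V 1, …, V s` is a stratification of step `s` of the Lie algebra `𝔤` of `G`:
`𝔤 = V 1 ⊕ ⋯ ⊕ V s`, `[V 1, V j] = V (j + 1)` for `1 ≤ j ≤ s - 1`, `[V 1, V s] = 0`, and the last
layer is nonzero (so that the step is exactly `s`). The values of `V` outside `1, …, s` play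
no role. -/
structure IsStratification (s : ℕ) (V : ℕ → Submodule ℝ (GroupLieAlgebra 𝓘(ℝ, E) G)) :
    Prop where
  one_le_step : 1 ≤ s
  isInternal : DirectSum.IsInternal (fun j : Fin s => V ((j : ℕ) + 1))
  bracket : ∀ j, 1 ≤ j → j < s → bracketSpan (V 1) (V j) = V (j + 1)
  bracket_last : bracketSpan (V 1) (V s) = ⊥
  last_ne_bot : V s ≠ ⊥

/-- The basis `(X 0, …, X (n - 1))` of the Lie algebra is adapted to the stratification
`V 1 ⊕ ⋯ ⊕ V s`, and `α i` is the index of the layer that contains `X i`. As the sum is direct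
and `α` is monotone, this says that the basis consists of a basis of `V 1`, followed by
a basis of `V 2`, and so on; `α i = 1` holds exactly for the first `m₁ = dim (V 1)` indices. -/
structure IsAdaptedBasis (s : ℕ) (V : ℕ → Submodule ℝ (GroupLieAlgebra 𝓘(ℝ, E) G)) {n : ℕ}
    (X : Module.Basis (Fin n) ℝ (GroupLieAlgebra 𝓘(ℝ, E) G)) (α : Fin n → ℕ) : Prop where
  mem_Icc : ∀ i, α i ∈ Set.Icc 1 s
  mem_layer : ∀ i, X i ∈ V (α i)
  monotone : Monotone α

open Classical in
/-- The exponential map of a Lie group: `exp v = γ 1`, where `γ` is the global integral curve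
starting at `1` of the left-invariant vector field whose value at `1` is `v`. (On a Lie group
this curve exists and is unique; the default value `1` is not used there.) -/
def lieExp (v : GroupLieAlgebra 𝓘(ℝ, E) G) : G :=
  if h : ∃ γ : ℝ → G, γ 0 = 1 ∧
      IsMIntegralCurve (I := 𝓘(ℝ, E)) γ (mulInvariantVectorField v) then
    h.choose 1
  else 1

/-- The point of `G` with exponential coordinates of the first kind `x = (x₁, …, xₙ)`, that is,
`exp (x₁ X₁ + ⋯ + xₙ Xₙ)`. On a Carnot group this is the identification of `ℝⁿ` with `G`. -/
def expPoint {n : ℕ} (X : Module.Basis (Fin n) ℝ (GroupLieAlgebra 𝓘(ℝ, E) G))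
    (x : Fin n → ℝ) : G :=
  lieExp (∑ i, x i • X i)

/-- The dilation `δ_l` in exponential coordinates. -/
def coordDilation {n : ℕ} (α : Fin n → ℕ) (l : ℝ) (x : Fin n → ℝ) : Fin n → ℝ :=
  fun i => l ^ α i * x i

/-- `d` is a homogeneous quasi-distance: a left-invariant quasi-distance that is one-homogeneous
with respect to the dilations, `d (δ_l p, δ_l q) = l * d (p, q)`, where the points `p`, `q` of
`G` are written in exponential coordinates. -/
structure IsHomogeneousQuasiDist {n : ℕ}
    (X : Module.Basis (Fin n) ℝ (GroupLieAlgebra 𝓘(ℝ, E) G)) (α : Fin n → ℕ)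
    (d : G → G → ℝ) : Prop where
  isQuasiDist : IsQuasiDist d
  left_invariant : ∀ p q q' : G, d (p * q) (p * q') = d q q'
  one_homogeneous : ∀ l : ℝ, 0 < l → ∀ x y : Fin n → ℝ,
    d (expPoint X (coordDilation α l x)) (expPoint X (coordDilation α l y)) =
      l * d (expPoint X x) (expPoint X y)

end Carnot

end

/-! Suppose some first-layer exponent `g = γ k` is less than `s`. Choose a basis vector `X l` of the
last layer with `l ≠ k`. Since `[V₁, V_s] = 0`, it commutes with `X k`, so the exponential turns
their span into an abelian subgroup: a plane with dilations `(r x, r ^ s y)`, on which `d` is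
translation invariant and has unit ball `a |x| ^ g + b |y| ^ h ≤ 1`.

Near its pole `(0, y₀)` this ball has a profile of the form `y₀ - C |x| ^ g`, which is sharper than
dilations allow. A fixed point `(x, y)` with `x > 0`, shrunk by `ε`, becomes `(x ε, y ε ^ s)`. Seen
from there, the horizontal offset of the pole adds order `ε ^ g` to the gauge, while the vertical
one changes it by only `O(ε ^ s)`. So the pole lies outside the unit ball around the shrunk point.
Scaling back by `ε⁻¹`, a point near the dilated pole is the center of a large ball through the
origin that avoids any finite set of earlier centers (`exists_seq_gauge`). Iterating gives
infinitely many balls through the origin, none containing another's center, which contradicts BCP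
(`not_satisfiesBCP_of_seq`).

The Lie-theoretic input is `lieExp_add`: `exp (u + v) = exp u * exp v` for commuting `u`, `v`. It
follows from the bracket being the derivative of the adjoint action, so that `Ad (exp (t v))` fixes
`u`. -/

/-! ### Gauge balls in the plane, and a combinatorial obstruction to BCP. -/

open Filter Topology in
/-- Moving by `ε ^ s` away from the pole `y₀` of the unit sphere costs `O(ε ^ s)`, which is
dominated by the gain `a * |x * ε| ^ g` when `g < s`. -/
theorem eventually_one_lt_gauge {a b g h x y y₀ : ℝ} {s : ℕ} (ha : 0 < a) (hs : 1 ≤ s)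
    (hgs : g < s) (hx : 0 < x) (hy₀ : 0 < y₀) (hb : b * y₀ ^ h = 1) :
    ∀ᶠ ε in 𝓝[>] (0 : ℝ), 1 < a * |0 - x * ε| ^ g + b * |y₀ - y * ε ^ s| ^ h := by
  -- Since `y₀ > 0`, the power is differentiable there even when `h < 1`; this gives the linear
  -- bound, used at `τ = ε ^ s`.
  have hdiff : DifferentiableAt ℝ (fun τ : ℝ => b * (y₀ - y * τ) ^ h) 0 := by
    refine DifferentiableAt.const_mul (DifferentiableAt.rpow_const (by fun_prop) ?_) b
    left; simpa using hy₀.ne'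
  obtain ⟨C, hC⟩ := hdiff.isBigO_sub.bound
  have hpow : Tendsto (fun ε : ℝ => ε ^ s) (𝓝[>] 0) (𝓝 0) := by
    have : Tendsto (fun ε : ℝ => ε ^ s) (𝓝 0) (𝓝 (0 ^ s)) := (continuous_pow s).tendsto 0
    rw [zero_pow (by omega)] at this
    exact this.mono_left nhdsWithin_le_nhds
  have h1 := hpow.eventually hC
  have h2 : Tendsto (fun ε : ℝ => C * ε ^ ((s : ℝ) - g)) (𝓝[>] 0) (𝓝 0) := by
    have : Tendsto (fun ε : ℝ => C * ε ^ ((s : ℝ) - g)) (𝓝 0) (𝓝 (C * 0 ^ ((s : ℝ) - g))) :=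
      (((Real.continuous_rpow_const (by linarith)).const_mul C).tendsto 0)
    rw [Real.zero_rpow (by linarith), mul_zero] at this
    exact this.mono_left nhdsWithin_le_nhds
  have h3 := h2.eventually (gt_mem_nhds (show 0 < a * x ^ g by positivity))
  have h4 : Tendsto (fun ε : ℝ => y₀ - y * ε ^ s) (𝓝[>] 0) (𝓝 (y₀ - y * 0)) :=
    tendsto_const_nhds.sub (hpow.const_mul y)
  have h5 := h4.eventually (lt_mem_nhds (show 0 < y₀ - y * 0 by simpa using hy₀))
  filter_upwards [h1, h3, h5, self_mem_nhdsWithin] with ε e1 e3 e5 (hε : 0 < ε)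
  rw [abs_of_pos e5, zero_sub, abs_neg, abs_of_pos (mul_pos hx hε),
    Real.mul_rpow hx.le hε.le]
  simp only [mul_zero, sub_zero, hb, Real.norm_eq_abs, abs_of_pos (pow_pos hε s)] at e1
  have e6 := (abs_le.1 e1).1
  have e7 : C * ε ^ s < a * x ^ g * ε ^ g := by
    calc C * ε ^ s = C * ε ^ ((s : ℝ) - g) * ε ^ g := by
          rw [mul_assoc, ← Real.rpow_add hε, sub_add_cancel, Real.rpow_natCast]
      _ < _ := by gcongr
  linarith

open Filter Topology in
/-- In the plane with dilations `(l x, l ^ s y)` and unit ball `{a |x| ^ g + b |y| ^ h ≤ 1}`,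
`g < s`, there are triples `(r, x, y)` such that the balls of radius `r` and center `(x, y)` all
contain the origin, whereas none contains the center of another one. -/
theorem exists_seq_gauge {a b g h : ℝ} {s : ℕ} (ha : 0 < a) (hb : 0 < b) (hg : 0 < g) (hh : 0 < h)
    (hs : 1 ≤ s) (hgs : g < s) :
    ∃ f : ℕ → ℝ × ℝ × ℝ,
      (∀ n, 0 < (f n).1 ∧ 0 < (f n).2.1 ∧
        a * |(f n).2.1 / (f n).1| ^ g + b * |(f n).2.2 / (f n).1 ^ s| ^ h ≤ 1) ∧
      ∀ m n, m < n → (f m).1 ≤ (f n).1 ∧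
        1 < a * |((f n).2.1 - (f m).2.1) / (f n).1| ^ g +
          b * |((f n).2.2 - (f m).2.2) / (f n).1 ^ s| ^ h := by
  -- It suffices to add one triple (radius, abscissa, ordinate) to any finite set `S` of earlier
  -- ones.
  refine exists_seq_of_forall_finset_exists
    (fun q : ℝ × ℝ × ℝ => 0 < q.1 ∧ 0 < q.2.1 ∧
      a * |q.2.1 / q.1| ^ g + b * |q.2.2 / q.1 ^ s| ^ h ≤ 1)
    (fun p q => p.1 ≤ q.1 ∧
        1 < a * |(q.2.1 - p.2.1) / q.1| ^ g + b * |(q.2.2 - p.2.2) / q.1 ^ s| ^ h) ?_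
  intro S hS
  -- Height of the upper boundary of the unit ball above the abscissa `ξ`; the pole is `(0, η 0)`.
  set η : ℝ → ℝ := fun ξ => ((1 - a * ξ ^ g) / b) ^ h⁻¹ with hη
  have hη0 : η 0 = (1 / b) ^ h⁻¹ := by simp [hη, Real.zero_rpow hg.ne']
  have hη0pos : 0 < η 0 := by rw [hη0]; positivity
  have hbη : b * (η 0) ^ h = 1 := by
    rw [hη0, ← Real.rpow_mul (by positivity), inv_mul_cancel₀ hh.ne', Real.rpow_one]
    field_simp
  have hηc : Continuous η := by
    refine Continuous.rpow_const ?_ (fun _ => Or.inr (by positivity))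
    exact (continuous_const.sub ((Real.continuous_rpow_const hg.le).const_mul a)).div_const b
  -- After shrinking by `ε`, the pole avoids the unit balls around all earlier centers; `ε ≤ p.1⁻¹`
  -- makes the new radius `ε⁻¹` at least the earlier ones.
  obtain ⟨ε, hε, hεS⟩ : ∃ ε : ℝ, 0 < ε ∧ ∀ p ∈ S, ε ≤ p.1⁻¹ ∧
      1 < a * |0 - p.2.1 * ε| ^ g + b * |η 0 - p.2.2 * ε ^ s| ^ h := by
    have : ∀ᶠ ε in 𝓝[>] (0 : ℝ), ∀ p ∈ S, ε ≤ p.1⁻¹ ∧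
        1 < a * |0 - p.2.1 * ε| ^ g + b * |η 0 - p.2.2 * ε ^ s| ^ h := by
      rw [Filter.eventually_all_finset]
      intro p hp
      obtain ⟨hp1, hp2, -⟩ := hS p hp
      refine Filter.Eventually.and ?_ (eventually_one_lt_gauge ha hs hgs hp2 hη0pos hbη)
      exact nhdsWithin_le_nhds (ge_mem_nhds (inv_pos.2 hp1))
    obtain ⟨ε, h1, h2⟩ := (this.and self_mem_nhdsWithin).exists
    exact ⟨ε, h2, h1⟩
  -- The pole has abscissa `0`, whereas the induction needs a positive one. The inequalities are
  -- strict, so they survive a small move along the sphere.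
  obtain ⟨ξ, hξ, hξ1, hξS⟩ : ∃ ξ : ℝ, 0 < ξ ∧ a * ξ ^ g < 1 ∧ ∀ p ∈ S,
      1 < a * |ξ - p.2.1 * ε| ^ g + b * |η ξ - p.2.2 * ε ^ s| ^ h := by
    have h1 : ∀ᶠ ξ in 𝓝[>] (0 : ℝ), ∀ p ∈ S,
        1 < a * |ξ - p.2.1 * ε| ^ g + b * |η ξ - p.2.2 * ε ^ s| ^ h := by
      rw [Filter.eventually_all_finset]
      intro p hp
      have hc : Continuous fun ξ : ℝ =>
          a * |ξ - p.2.1 * ε| ^ g + b * |η ξ - p.2.2 * ε ^ s| ^ h := by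
        refine Continuous.add (Continuous.const_mul (Continuous.rpow_const (by fun_prop)
          fun _ => Or.inr hg.le) a) (Continuous.const_mul (Continuous.rpow_const (by fun_prop)
          fun _ => Or.inr hh.le) b)
      exact nhdsWithin_le_nhds ((hc.tendsto 0).eventually (lt_mem_nhds (hεS p hp).2))
    have h2 : ∀ᶠ ξ in 𝓝[>] (0 : ℝ), a * ξ ^ g < 1 := by
      have hc : Continuous fun ξ : ℝ => a * ξ ^ g := (Real.continuous_rpow_const hg.le).const_mul a
      refine nhdsWithin_le_nhds ((hc.tendsto 0).eventually (gt_mem_nhds ?_))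
      simp [Real.zero_rpow hg.ne']
    obtain ⟨ξ, ⟨h1, h2⟩, h3⟩ := ((h1.and h2).and self_mem_nhdsWithin).exists
    exact ⟨ξ, h3, h2, h1⟩
  -- The new center is the dilation by `ε⁻¹` of the point `(ξ, η ξ)` of the unit sphere.
  refine ⟨(ε⁻¹, ε⁻¹ * ξ, (ε⁻¹) ^ s * η ξ), ⟨by positivity, by positivity, ?_⟩, ?_⟩
  · have e1 : ε⁻¹ * ξ / ε⁻¹ = ξ := by field_simp
    have e2 : (ε⁻¹) ^ s * η ξ / (ε⁻¹) ^ s = η ξ := by field_simp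
    have h0 : 0 ≤ (1 - a * ξ ^ g) / b := div_nonneg (by linarith) hb.le
    have e3 : b * η ξ ^ h = 1 - a * ξ ^ g := by
      simp only [hη]
      rw [← Real.rpow_mul h0, inv_mul_cancel₀ hh.ne', Real.rpow_one]
      field_simp
    simp only [e1, e2]
    rw [abs_of_pos hξ, abs_of_nonneg (Real.rpow_nonneg h0 _), e3]
    linarith
  · intro p hp
    refine ⟨?_, ?_⟩
    · rw [le_inv_comm₀ (hS p hp).1 hε]
      exact (hεS p hp).1
    · have e1 : (ε⁻¹ * ξ - p.2.1) / ε⁻¹ = ξ - p.2.1 * ε := by field_simp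
      have e2 : ((ε⁻¹) ^ s * η ξ - p.2.2) / (ε⁻¹) ^ s = η ξ - p.2.2 * ε ^ s := by
        rw [inv_pow]; field_simp
      simp only [e1, e2]
      exact hξS p hp

/-- BCP fails if there are infinitely many balls with a common point, none of which contains the
center of another one. -/
theorem not_satisfiesBCP_of_seq {X : Type*} {d : X → X → ℝ} (hd : ∀ p, d p p = 0) {p : ℕ → X}
    {r : ℕ → ℝ} (hr : ∀ n, 0 < r n) {x : X} (hx : ∀ n, d x (p n) ≤ r n)
    (hsep : ∀ m n, m ≠ n → r n < d (p m) (p n)) : ¬ SatisfiesBCP d := by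
  rintro ⟨N, hN⟩
  set B : ℕ → Set X := fun n => qBall d (p n) (r n) with hB
  have hmem : ∀ m n, p m ∈ B n ↔ m = n := by
    intro m n
    refine ⟨fun h => ?_, ?_⟩
    · by_contra hne
      exact absurd h (not_le.2 (hsep m n hne))
    · rintro rfl
      change d (p m) (p m) ≤ r m
      rw [hd]
      exact (hr m).le
  -- Multiplicity counts balls as sets, so distinct indices must give distinct sets.
  have hinj : Function.Injective B := fun m n h => (hmem m n).1 (h ▸ (hmem m m).2 rfl)
  obtain ⟨F, hF, -, hA, hmult⟩ := hN (p '' Set.Iio (N + 1)) (B '' Set.Iio (N + 1)) (by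
      have hfin : ((fun q : ℕ × ℕ => d (p q.1) (p q.2)) ''
        (Set.Iio (N + 1) ×ˢ Set.Iio (N + 1))).Finite :=
        ((Set.finite_Iio _).prod (Set.finite_Iio _)).image _
      obtain ⟨R, hR⟩ := hfin.bddAbove
      refine ⟨R, ?_⟩
      rintro _ ⟨m, hm, rfl⟩ _ ⟨n, hn, rfl⟩
      exact hR ⟨(m, n), ⟨hm, hn⟩, rfl⟩)
    (by rintro _ ⟨n, -, rfl⟩; exact ⟨p n, r n, hr n, rfl⟩)
    (by rintro _ ⟨n, hn, rfl⟩; exact ⟨r n, hr n, n, hn, rfl⟩)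
  -- Only `B n` covers `p n`, so the subfamily must retain all `N + 1` balls, and each of them
  -- contains `x`.
  have hsub : B '' Set.Iio (N + 1) ⊆ {B ∈ F | x ∈ B} := by
    rintro _ ⟨n, hn, rfl⟩
    refine ⟨?_, hx n⟩
    obtain ⟨C, hC, hnC⟩ := hA ⟨n, hn, rfl⟩
    obtain ⟨m, -, rfl⟩ := hF hC
    rwa [(hmem n m).1 hnC]
  have hcard := (Set.encard_le_encard hsub).trans (hmult x)
  rw [hinj.encard_image, ← Finset.coe_Iio, Set.encard_coe_eq_coe_finsetCard, Nat.card_Iio] at hcard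
  exact absurd (Nat.cast_le.1 hcard) (by omega)

/-! ### The Lie bracket as the derivative of the adjoint action, in a chart. -/

open Filter Topology VectorField in
/-- In a chart with group law `m` and conjugation `k`, the derivative at the identity `e` of the
adjoint action is given by the Lie bracket of the left-invariant vector fields. -/
theorem hasFDerivAt_partial_fderiv_conj {E : Type*} [NormedAddCommGroup E] [NormedSpace ℝ E]
    {m k : E × E → E} {e : E} (hm : ContDiffAt ℝ 2 m (e, e)) (hk : ContDiffAt ℝ 2 k (e, e))
    (hm_left : ∀ᶠ x in 𝓝 e, m (x, e) = x) (hm_right : ∀ᶠ y in 𝓝 e, m (e, y) = y)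
    (hk_one : ∀ᶠ x in 𝓝 e, k (x, e) = e) (hk_id : ∀ᶠ y in 𝓝 e, k (e, y) = y)
    (hmk : ∀ᶠ p in 𝓝 (e, e), m p = m (k p, p.1)) (u v : E) :
    ∃ F' : E →L[ℝ] E,
      HasFDerivAt (fun x => fderiv ℝ (fun y => k (x, y)) e u) F' e ∧
      F' v = lieBracket ℝ (fun x => fderiv ℝ (fun y => m (x, y)) e v)
        (fun x => fderiv ℝ (fun y => m (x, y)) e u) e := by
  have hc1 : Tendsto (fun x : E => (x, e)) (𝓝 e) (𝓝 (e, e)) :=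
    (Continuous.prodMk_left e).tendsto e
  have hc2 : Tendsto (fun x : E => (e, x)) (𝓝 e) (𝓝 (e, e)) :=
    (Continuous.prodMk_right e).tendsto e
  have hmd : ∀ᶠ p in 𝓝 (e, e), DifferentiableAt ℝ m p :=
    (hm.eventually (by simp)).mono fun p hp => hp.differentiableAt (by simp)
  have hkd : ∀ᶠ p in 𝓝 (e, e), DifferentiableAt ℝ k p :=
    (hk.eventually (by simp)).mono fun p hp => hp.differentiableAt (by simp)
  have hm2 : HasFDerivAt (fderiv ℝ m) (fderiv ℝ (fderiv ℝ m) (e, e)) (e, e) :=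
    ((hm.fderiv_right (m := 1) (by norm_num)).differentiableAt (by simp)).hasFDerivAt
  have hk2 : HasFDerivAt (fderiv ℝ k) (fderiv ℝ (fderiv ℝ k) (e, e)) (e, e) :=
    ((hk.fderiv_right (m := 1) (by norm_num)).differentiableAt (by simp)).hasFDerivAt
  set D := fderiv ℝ (fderiv ℝ m) (e, e) with hD
  have hsymm : ∀ p q, D p q = D q p := fun p q => (hm.isSymmSndFDerivAt (by simp)) p q
  have hj1 : ∀ x : E, HasFDerivAt (fun x : E => (x, e)) (ContinuousLinearMap.inl ℝ E E) x :=
    fun x => hasFDerivAt_prodMk_left x e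
  have hj2 : ∀ (x y : E), HasFDerivAt (fun y : E => (x, y)) (ContinuousLinearMap.inr ℝ E E) y :=
    fun x y => hasFDerivAt_prodMk_right x y
  have partial_eq : ∀ {f : E × E → E}, (∀ᶠ p in 𝓝 (e, e), DifferentiableAt ℝ f p) → ∀ w,
      (fun x => fderiv ℝ (fun y => f (x, y)) e w) =ᶠ[𝓝 e] fun x => fderiv ℝ f (x, e) (0, w) := by
    intro f hf w
    filter_upwards [hc1.eventually hf] with x hx
    have := (hx.hasFDerivAt.comp e (hj2 x e)).fderiv
    change fderiv ℝ (f ∘ fun y => (x, y)) e w = _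
    rw [this]
    simp
  have hL : ∀ w, HasFDerivAt (fun x => fderiv ℝ m (x, e) (0, w))
      ((ContinuousLinearMap.apply ℝ E ((0 : E), w)).comp
        (D.comp (ContinuousLinearMap.inl ℝ E E))) e := fun w =>
    (ContinuousLinearMap.hasFDerivAt (ContinuousLinearMap.apply ℝ E ((0 : E), w))).comp e
      (HasFDerivAt.comp (g := fderiv ℝ m) e hm2 (hj1 e))
  have hR : HasFDerivAt (fun x => fderiv ℝ m (e, x))
      (D.comp (ContinuousLinearMap.inr ℝ E E)) e :=
    HasFDerivAt.comp (g := fderiv ℝ m) e hm2 (hj2 e e)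
  have hK : HasFDerivAt (fun x => fderiv ℝ k (x, e) (0, u))
      ((ContinuousLinearMap.apply ℝ E ((0 : E), u)).comp
        ((fderiv ℝ (fderiv ℝ k) (e, e)).comp (ContinuousLinearMap.inl ℝ E E))) e :=
    (ContinuousLinearMap.hasFDerivAt (ContinuousLinearMap.apply ℝ E ((0 : E), u))).comp e
      (HasFDerivAt.comp (g := fderiv ℝ k) e hk2 (hj1 e))
  set F' := (ContinuousLinearMap.apply ℝ E ((0 : E), u)).comp
        ((fderiv ℝ (fderiv ℝ k) (e, e)).comp (ContinuousLinearMap.inl ℝ E E)) with hF'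
  have me1 : ∀ z, fderiv ℝ m (e, e) (z, 0) = z := by
    intro z
    have h1 := HasFDerivAt.comp (f := fun x => (x, e)) e hmd.self_of_nhds.hasFDerivAt (hj1 e)
    have h2 : HasFDerivAt (m ∘ fun x => (x, e)) (ContinuousLinearMap.id ℝ E) e :=
      (hasFDerivAt_id e).congr_of_eventuallyEq hm_left
    simpa using congrArg (fun A : E →L[ℝ] E => A z) (h1.unique h2)
  have me2 : ∀ z, fderiv ℝ m (e, e) (0, z) = z := by
    intro z
    have h1 := (hmd.self_of_nhds.hasFDerivAt.comp e (hj2 e e))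
    have h2 : HasFDerivAt (m ∘ fun x => (e, x)) (ContinuousLinearMap.id ℝ E) e :=
      (hasFDerivAt_id e).congr_of_eventuallyEq hm_right
    simpa using congrArg (fun A : E →L[ℝ] E => A z) (h1.unique h2)
  have ke : fderiv ℝ k (e, e) (0, u) = u := by
    have h1 := (hkd.self_of_nhds.hasFDerivAt.comp e (hj2 e e))
    have h2 : HasFDerivAt (k ∘ fun x => (e, x)) (ContinuousLinearMap.id ℝ E) e :=
      (hasFDerivAt_id e).congr_of_eventuallyEq hk_id
    simpa using congrArg (fun A : E →L[ℝ] E => A u) (h1.unique h2)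
  -- This is `x y = (x y x⁻¹) x` differentiated in `y` at `e` along `u`; differentiating next in `x`
  -- along `v` gives `key`.
  have hprod : (fun x => fderiv ℝ m (x, e) (0, u)) =ᶠ[𝓝 e]
      fun x => fderiv ℝ m (e, x) (fderiv ℝ k (x, e) (0, u), 0) := by
    filter_upwards [hc1.eventually hmd, hc2.eventually hmd, hc1.eventually hkd, hk_one,
      hc1.eventually hmk.eventually_nhds] with x h1 h2 h3 h4 h5
    have a1 := h1.hasFDerivAt.comp e (hj2 x e)
    have a2 : HasFDerivAt (fun y => (k (x, y), x)) _ e :=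
      (h3.hasFDerivAt.comp e (hj2 x e)).prodMk (hasFDerivAt_const x e)
    have a3 : HasFDerivAt (m ∘ fun y => (k (x, y), x)) _ e :=
      HasFDerivAt.comp (g' := fderiv ℝ m (e, x)) e (by rw [h4]; exact h2.hasFDerivAt) a2
    have a4 : (m ∘ fun y => (x, y)) =ᶠ[𝓝 e] (m ∘ fun y => (k (x, y), x)) :=
      ((Continuous.prodMk_right x).tendsto e).eventually h5
    simpa using congrArg (fun A : E →L[ℝ] E => A u) (a1.unique (a3.congr_of_eventuallyEq a4))
  have hpd : HasFDerivAt (fun x => fderiv ℝ m (e, x) (fderiv ℝ k (x, e) (0, u), 0)) _ e :=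
    hR.clm_apply (hK.prodMk (hasFDerivAt_const (0 : E) e))
  have key := congrArg (fun A : E →L[ℝ] E => A v)
    ((hL u).unique (hpd.congr_of_eventuallyEq hprod))
  simp only [ContinuousLinearMap.comp_apply, ContinuousLinearMap.inl_apply,
    ContinuousLinearMap.apply_apply, add_apply,
    ContinuousLinearMap.flip_apply, ContinuousLinearMap.prod_apply,
    zero_apply, ContinuousLinearMap.inr_apply, ke, me1] at key
  refine ⟨F', hK.congr_of_eventuallyEq (partial_eq hkd u), ?_⟩
  rw [lieBracket, (partial_eq hmd u).fderiv_eq, (partial_eq hmd v).fderiv_eq,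
    (hL u).fderiv, (hL v).fderiv]
  have hu := (partial_eq hmd u).self_of_nhds
  have hv := (partial_eq hmd v).self_of_nhds
  simp only [me2] at hu hv
  rw [hu, hv]
  simp only [ContinuousLinearMap.comp_apply, ContinuousLinearMap.inl_apply,
    ContinuousLinearMap.apply_apply]
  -- Symmetry of the second derivative of `m` turns the remaining mixed term into the second term of
  -- the bracket.
  rw [key, hsymm (0, v) (u, 0)]
  abel

section LieGroupCalculus

open Filter Topology VectorField

variable {E : Type*} [NormedAddCommGroup E] [NormedSpace ℝ E]
  {G : Type*} [TopologicalSpace G] [ChartedSpace E G]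

/-- The derivative of a self-map of a manifold modelled on `E`, as an endomorphism of the model
space. -/
noncomputable def modelDeriv (f : G → G) (x : G) : E →L[ℝ] E :=
  mfderiv 𝓘(ℝ, E) 𝓘(ℝ, E) f x

theorem modelDeriv_comp {f g : G → G} {x : G} (hg : MDifferentiableAt 𝓘(ℝ, E) 𝓘(ℝ, E) g (f x))
    (hf : MDifferentiableAt 𝓘(ℝ, E) 𝓘(ℝ, E) f x) (u : E) :
    (modelDeriv (fun y => g (f y)) x : E →L[ℝ] E) u =
      (modelDeriv g (f x) : E →L[ℝ] E) ((modelDeriv f x : E →L[ℝ] E) u) :=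
  congrArg (fun A : E →L[ℝ] E => A u) (mfderiv_comp x hg hf)

theorem modelDeriv_id (x : G) (u : E) : (modelDeriv (fun y : G => y) x : E →L[ℝ] E) u = u :=
  congrArg (fun A : E →L[ℝ] E => A u) (mfderiv_id (I := 𝓘(ℝ, E)) (x := x))

/-- The derivative at the center of the chart of a map read in the chart in the source. -/
theorem fderiv_extChartAt_comp_symm [IsManifold 𝓘(ℝ, E) ∞ G] {f : G → G} {x : G}
    (hf : MDifferentiableAt 𝓘(ℝ, E) 𝓘(ℝ, E) f x)
    (hfx : f x ∈ (extChartAt 𝓘(ℝ, E) x).source) (u : E) :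
    fderiv ℝ (fun y => extChartAt 𝓘(ℝ, E) x (f ((extChartAt 𝓘(ℝ, E) x).symm y)))
      (extChartAt 𝓘(ℝ, E) x x) u =
    (mfderiv 𝓘(ℝ, E) 𝓘(ℝ, E) (extChartAt 𝓘(ℝ, E) x) (f x) : E →L[ℝ] E)
      ((modelDeriv f x : E →L[ℝ] E) u) := by
  have h1 : HasMFDerivAt 𝓘(ℝ, E) 𝓘(ℝ, E) (extChartAt 𝓘(ℝ, E) x).symm (extChartAt 𝓘(ℝ, E) x x)
      (ContinuousLinearMap.id ℝ E) := by
    have h := (mdifferentiableWithinAt_extChartAt_symm (I := 𝓘(ℝ, E)) (x := x)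
      (mem_extChartAt_target x)).hasMFDerivWithinAt
    rw [mfderivWithin_range_extChartAt_symm] at h
    exact h.hasMFDerivAt (by simp)
  have e : (extChartAt 𝓘(ℝ, E) x).symm (extChartAt 𝓘(ℝ, E) x x) = x := extChartAt_to_inv x
  have h2 : HasMFDerivAt 𝓘(ℝ, E) 𝓘(ℝ, E) f ((extChartAt 𝓘(ℝ, E) x).symm (extChartAt 𝓘(ℝ, E) x x))
      (modelDeriv f x : E →L[ℝ] E) := by
    rw [e]; exact hf.hasMFDerivAt
  have h3 : HasMFDerivAt 𝓘(ℝ, E) 𝓘(ℝ, E) (extChartAt 𝓘(ℝ, E) x)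
      (f ((extChartAt 𝓘(ℝ, E) x).symm (extChartAt 𝓘(ℝ, E) x x)))
      (mfderiv 𝓘(ℝ, E) 𝓘(ℝ, E) (extChartAt 𝓘(ℝ, E) x) (f x) : E →L[ℝ] E) := by
    rw [e]
    exact (mdifferentiableAt_extChartAt (by simpa using hfx)).hasMFDerivAt
  set L : E →L[ℝ] E :=
    (mfderiv 𝓘(ℝ, E) 𝓘(ℝ, E) (extChartAt 𝓘(ℝ, E) x) (f x) : E →L[ℝ] E).comp
      ((modelDeriv f x : E →L[ℝ] E).comp (ContinuousLinearMap.id ℝ E)) with hL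
  have h4 : HasMFDerivAt 𝓘(ℝ, E) 𝓘(ℝ, E)
      (fun y => extChartAt 𝓘(ℝ, E) x (f ((extChartAt 𝓘(ℝ, E) x).symm y)))
      (extChartAt 𝓘(ℝ, E) x x) L :=
    HasMFDerivAt.comp (extChartAt 𝓘(ℝ, E) x x) h3 (HasMFDerivAt.comp (extChartAt 𝓘(ℝ, E) x x) h2 h1)
  have h5 : HasFDerivAt (fun y => extChartAt 𝓘(ℝ, E) x (f ((extChartAt 𝓘(ℝ, E) x).symm y))) L
      (extChartAt 𝓘(ℝ, E) x x) := hasMFDerivAt_iff_hasFDerivAt.1 h4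
  exact congrArg (fun A : E →L[ℝ] E => A u) h5.fderiv

variable [Group G]

/-- The adjoint action of `G` on its tangent space at the identity. -/
noncomputable def adjointAction (g : G) : E →L[ℝ] E :=
  modelDeriv (fun x : G => g * x * g⁻¹) 1

theorem adjointAction_one (u : E) : (adjointAction (1 : G) : E →L[ℝ] E) u = u := by
  simp only [adjointAction, one_mul, inv_one, mul_one]
  exact modelDeriv_id 1 u

theorem mulInvariantVectorField_one_apply (v : E) :
    (mulInvariantVectorField (I := 𝓘(ℝ, E)) v (1 : G) : E) = v := by
  have h : (modelDeriv (fun x : G => 1 * x) 1 : E →L[ℝ] E) v = v := by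
    simp only [one_mul]
    exact modelDeriv_id 1 v
  exact h

variable [LieGroup 𝓘(ℝ, E) ∞ G]

/-- The group law of `G` in the chart at the identity. -/
noncomputable def chartMul (E : Type*) [NormedAddCommGroup E] [NormedSpace ℝ E] (G : Type*)
    [TopologicalSpace G] [ChartedSpace E G] [Group G] (p : E × E) : E :=
  extChartAt 𝓘(ℝ, E) (1 : G)
    ((extChartAt 𝓘(ℝ, E) (1 : G)).symm p.1 * (extChartAt 𝓘(ℝ, E) (1 : G)).symm p.2)

/-- The conjugation of `G` in the chart at the identity. -/
noncomputable def chartConj (E : Type*) [NormedAddCommGroup E] [NormedSpace ℝ E] (G : Type*)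
    [TopologicalSpace G] [ChartedSpace E G] [Group G] (p : E × E) : E :=
  extChartAt 𝓘(ℝ, E) (1 : G)
    ((extChartAt 𝓘(ℝ, E) (1 : G)).symm p.1 * (extChartAt 𝓘(ℝ, E) (1 : G)).symm p.2 *
      ((extChartAt 𝓘(ℝ, E) (1 : G)).symm p.1)⁻¹)

theorem mdifferentiableAt_mul_mul (a b x : G) :
    MDifferentiableAt 𝓘(ℝ, E) 𝓘(ℝ, E) (fun y => a * y * b) x :=
  ContMDiff.mdifferentiableAt
    ((contMDiff_mul_right (I := 𝓘(ℝ, E)) (n := ∞) (a := b)).comp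
      (contMDiff_mul_left (I := 𝓘(ℝ, E)) (n := ∞) (a := a))) (by simp)

theorem mdifferentiableAt_mul_left_model (a x : G) :
    MDifferentiableAt 𝓘(ℝ, E) 𝓘(ℝ, E) (fun y => a * y) x :=
  ContMDiff.mdifferentiableAt (contMDiff_mul_left (I := 𝓘(ℝ, E)) (n := ∞) (a := a)) (by simp)

theorem mdifferentiableAt_mul_right_model (a x : G) :
    MDifferentiableAt 𝓘(ℝ, E) 𝓘(ℝ, E) (fun y => y * a) x :=
  ContMDiff.mdifferentiableAt (contMDiff_mul_right (I := 𝓘(ℝ, E)) (n := ∞) (a := a)) (by simp)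

theorem adjointAction_mul (g h : G) (u : E) :
    (adjointAction (g * h) : E →L[ℝ] E) u =
      (adjointAction g : E →L[ℝ] E) ((adjointAction h : E →L[ℝ] E) u) := by
  have h1 := modelDeriv_comp (E := E) (f := fun x : G => h * x * h⁻¹)
    (g := fun x : G => g * x * g⁻¹) (x := 1) (mdifferentiableAt_mul_mul _ _ _)
    (mdifferentiableAt_mul_mul _ _ _) u
  have h2 : (fun y : G => g * (h * y * h⁻¹) * g⁻¹) = fun y => (g * h) * y * (g * h)⁻¹ := by
    ext y; group
  simp only [h2, mul_one, mul_inv_cancel] at h1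
  exact h1

theorem contMDiffAt_extChartAt_one_symm :
    ContMDiffAt 𝓘(ℝ, E) 𝓘(ℝ, E) ∞ (extChartAt 𝓘(ℝ, E) (1 : G)).symm
      (extChartAt 𝓘(ℝ, E) (1 : G) 1) :=
  (contMDiffOn_extChartAt_symm (I := 𝓘(ℝ, E)) (n := ∞) (1 : G)).contMDiffAt
    (extChartAt_target_mem_nhds 1)

theorem contDiffAt_chartMul :
    ContDiffAt ℝ ∞ (chartMul E G) (extChartAt 𝓘(ℝ, E) (1 : G) 1, extChartAt 𝓘(ℝ, E) (1 : G) 1) := by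
  rw [← contMDiffAt_iff_contDiffAt]
  set e := extChartAt 𝓘(ℝ, E) (1 : G) 1
  have h := contMDiffAt_extChartAt_one_symm (E := E) (G := G)
  have h1 : ContMDiffAt 𝓘(ℝ, E × E) 𝓘(ℝ, E) ∞
      (fun p : E × E => (extChartAt 𝓘(ℝ, E) (1 : G)).symm p.1) (e, e) :=
    ContMDiffAt.comp (e, e) h contDiff_fst.contMDiff.contMDiffAt
  have h2 : ContMDiffAt 𝓘(ℝ, E × E) 𝓘(ℝ, E) ∞
      (fun p : E × E => (extChartAt 𝓘(ℝ, E) (1 : G)).symm p.2) (e, e) :=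
    ContMDiffAt.comp (e, e) h contDiff_snd.contMDiff.contMDiffAt
  refine ContMDiffAt.comp (I' := 𝓘(ℝ, E)) (e, e) ?_ (h1.mul h2)
  refine contMDiffAt_extChartAt' ?_
  simp [e]

theorem contDiffAt_chartConj :
    ContDiffAt ℝ ∞ (chartConj E G) (extChartAt 𝓘(ℝ, E) (1 : G) 1, extChartAt 𝓘(ℝ, E) (1 : G) 1) := by
  rw [← contMDiffAt_iff_contDiffAt]
  set e := extChartAt 𝓘(ℝ, E) (1 : G) 1
  have h := contMDiffAt_extChartAt_one_symm (E := E) (G := G)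
  have h1 : ContMDiffAt 𝓘(ℝ, E × E) 𝓘(ℝ, E) ∞
      (fun p : E × E => (extChartAt 𝓘(ℝ, E) (1 : G)).symm p.1) (e, e) :=
    ContMDiffAt.comp (e, e) h contDiff_fst.contMDiff.contMDiffAt
  have h2 : ContMDiffAt 𝓘(ℝ, E × E) 𝓘(ℝ, E) ∞
      (fun p : E × E => (extChartAt 𝓘(ℝ, E) (1 : G)).symm p.2) (e, e) :=
    ContMDiffAt.comp (e, e) h contDiff_snd.contMDiff.contMDiffAt
  refine ContMDiffAt.comp (I' := 𝓘(ℝ, E)) (e, e) ?_ ((h1.mul h2).mul h1.inv)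
  refine contMDiffAt_extChartAt' ?_
  simp [e]

/-- The derivative of the inverse chart is inverted by that of the chart, so the pullback is the
chart derivative applied to the left translate of `v`; the chain rule identifies it with a partial
derivative of `chartMul`. -/
theorem mpullbackWithin_mulInvariantVectorField (v : GroupLieAlgebra 𝓘(ℝ, E) G) {x : E}
    (hx : x ∈ (extChartAt 𝓘(ℝ, E) (1 : G)).target) :
    (mpullbackWithin 𝓘(ℝ, E) 𝓘(ℝ, E) (extChartAt 𝓘(ℝ, E) (1 : G)).symm
      (mulInvariantVectorField v) (Set.range 𝓘(ℝ, E)) x : E) =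
    fderiv ℝ (fun y => chartMul E G (x, y)) (extChartAt 𝓘(ℝ, E) (1 : G) 1) v := by
  set g := (extChartAt 𝓘(ℝ, E) (1 : G)).symm x with hg
  have hgs : g ∈ (extChartAt 𝓘(ℝ, E) (1 : G)).source := (extChartAt 𝓘(ℝ, E) (1 : G)).map_target hx
  have h1 := fderiv_extChartAt_comp_symm (E := E) (f := fun y : G => g * y) (x := 1)
    (mdifferentiableAt_mul_left_model g 1) (by simpa using hgs) v
  refine Eq.trans ?_ h1.symm
  have h2 := ContinuousLinearMap.inverse_eq
    (mfderivWithin_extChartAt_symm_comp_mfderiv_extChartAt hx)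
    (mfderiv_extChartAt_comp_mfderivWithin_extChartAt_symm hx)
  rw [mpullbackWithin_apply, h2]
  -- The base points `g * 1` and `g` are equal but not definitionally so; the derivative is
  -- transported along the equality.
  have h3 : ∀ g' : G, g' = g → ∀ z : E,
      (mfderiv 𝓘(ℝ, E) 𝓘(ℝ, E) (extChartAt 𝓘(ℝ, E) (1 : G)) g : E →L[ℝ] E) z =
      (mfderiv 𝓘(ℝ, E) 𝓘(ℝ, E) (extChartAt 𝓘(ℝ, E) (1 : G)) g' : E →L[ℝ] E) z := by
    rintro _ rfl z; rfl
  exact h3 (g * 1) (mul_one g) _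

/-- The Lie bracket at the identity, computed in the chart at the identity. -/
noncomputable def chartBracket (E : Type*) [NormedAddCommGroup E] [NormedSpace ℝ E] (G : Type*)
    [TopologicalSpace G] [ChartedSpace E G] [Group G] (v u : E) : E :=
  lieBracket ℝ
    (fun x => fderiv ℝ (fun y => chartMul E G (x, y)) (extChartAt 𝓘(ℝ, E) (1 : G) 1) v)
    (fun x => fderiv ℝ (fun y => chartMul E G (x, y)) (extChartAt 𝓘(ℝ, E) (1 : G) 1) u)
    (extChartAt 𝓘(ℝ, E) (1 : G) 1)

/-- The bracket depends only on the germs of the pulled-back fields, and the chart has derivative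
the identity at its center. -/
theorem lie_eq_chartBracket (v u : GroupLieAlgebra 𝓘(ℝ, E) G) :
    (⁅v, u⁆ : GroupLieAlgebra 𝓘(ℝ, E) G) = chartBracket E G v u := by
  have hev : ∀ w : GroupLieAlgebra 𝓘(ℝ, E) G, (mpullbackWithin 𝓘(ℝ, E) 𝓘(ℝ, E)
      (extChartAt 𝓘(ℝ, E) (1 : G)).symm (mulInvariantVectorField w) (Set.range 𝓘(ℝ, E)) : E → E)
      =ᶠ[𝓝 (extChartAt 𝓘(ℝ, E) (1 : G) 1)] fun x =>
        fderiv ℝ (fun y => chartMul E G (x, y)) (extChartAt 𝓘(ℝ, E) (1 : G) 1) w := fun w => by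
    filter_upwards [extChartAt_target_mem_nhds (I := 𝓘(ℝ, E)) (1 : G)] with x hx
    exact mpullbackWithin_mulInvariantVectorField w hx
  have hid : ∀ A : E →L[ℝ] E, A = ContinuousLinearMap.id ℝ E → ∀ z, A.inverse z = z := by
    rintro _ rfl z
    rw [ContinuousLinearMap.inverse_id]; rfl
  have hbr : ∀ (V W V' W' : E → E) (S : Set E) (x : E), S = Set.univ → V =ᶠ[𝓝 x] V' →
      W =ᶠ[𝓝 x] W' → lieBracketWithin ℝ V W S x = lieBracket ℝ V' W' x := by
    rintro V W V' W' _ x rfl hV hW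
    rw [lieBracketWithin_univ]
    exact hV.lieBracket_vectorField_eq hW
  rw [GroupLieAlgebra.bracket_def, mlieBracket, mlieBracketWithin_apply]
  exact (hid _ mfderiv_extChartAt_self _).trans
    (hbr _ _ _ _ _ _ (by simp) (hev v) (hev u))

end LieGroupCalculus

/-! ### One-parameter subgroups and the exponential of commuting vectors. -/

section LieGroupExponential

open Filter Topology VectorField

variable {E : Type*} [NormedAddCommGroup E] [NormedSpace ℝ E]
  {G : Type*} [TopologicalSpace G] [ChartedSpace E G] [Group G] [LieGroup 𝓘(ℝ, E) ∞ G]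

/-- Conjugation fixes `1`, so the chart is differentiated at its own center and contributes the
identity. -/
theorem fderiv_chartConj_eq_adjointAction (u : E) {x : E} :
    fderiv ℝ (fun y => chartConj E G (x, y)) (extChartAt 𝓘(ℝ, E) (1 : G) 1) u =
      (adjointAction ((extChartAt 𝓘(ℝ, E) (1 : G)).symm x) : E →L[ℝ] E) u := by
  set g := (extChartAt 𝓘(ℝ, E) (1 : G)).symm x
  have h1 := fderiv_extChartAt_comp_symm (E := E) (f := fun y : G => g * y * g⁻¹) (x := 1)
    (mdifferentiableAt_mul_mul g g⁻¹ 1) (by simp) u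
  refine Eq.trans h1 ?_
  have h2 : ∀ h : G, h = 1 → ∀ z : E,
      (mfderiv 𝓘(ℝ, E) 𝓘(ℝ, E) (extChartAt 𝓘(ℝ, E) (1 : G)) h : E →L[ℝ] E) z = z := by
    rintro _ rfl z
    exact congrArg (fun A : E →L[ℝ] E => A z) mfderiv_extChartAt_self
  exact h2 _ (by simp) _

theorem exists_hasFDerivAt_adjointAction (u v : E) :
    ∃ F' : E →L[ℝ] E,
      HasFDerivAt (fun x => (adjointAction ((extChartAt 𝓘(ℝ, E) (1 : G)).symm x) : E →L[ℝ] E) u)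
        F' (extChartAt 𝓘(ℝ, E) (1 : G) 1) ∧ F' v = chartBracket E G v u := by
  set e := extChartAt 𝓘(ℝ, E) (1 : G) 1 with he
  have hφe : (extChartAt 𝓘(ℝ, E) (1 : G)).symm e = 1 := extChartAt_to_inv 1
  have htarget := extChartAt_target_mem_nhds (I := 𝓘(ℝ, E)) (1 : G)
  have hcont : ContinuousAt (extChartAt 𝓘(ℝ, E) (1 : G)).symm e := continuousAt_extChartAt_symm 1
  have hc1 : ContinuousAt (fun p : E × E => (extChartAt 𝓘(ℝ, E) (1 : G)).symm p.1) (e, e) :=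
    ContinuousAt.comp (f := Prod.fst) (x := (e, e)) hcont continuousAt_fst
  have hc2 : ContinuousAt (fun p : E × E => (extChartAt 𝓘(ℝ, E) (1 : G)).symm p.2) (e, e) :=
    ContinuousAt.comp (f := Prod.snd) (x := (e, e)) hcont continuousAt_snd
  have : IsTopologicalGroup G := topologicalGroup_of_lieGroup 𝓘(ℝ, E) ∞
  have hconj : ∀ᶠ p : E × E in 𝓝 (e, e), (extChartAt 𝓘(ℝ, E) (1 : G)).symm p.1 *
      (extChartAt 𝓘(ℝ, E) (1 : G)).symm p.2 * ((extChartAt 𝓘(ℝ, E) (1 : G)).symm p.1)⁻¹ ∈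
      (extChartAt 𝓘(ℝ, E) (1 : G)).source := by
    have h0 : (extChartAt 𝓘(ℝ, E) (1 : G)).symm e * (extChartAt 𝓘(ℝ, E) (1 : G)).symm e *
        ((extChartAt 𝓘(ℝ, E) (1 : G)).symm e)⁻¹ = 1 := by rw [hφe]; group
    refine ((hc1.mul hc2).mul hc1.inv).eventually_mem ?_
    change _ ∈ 𝓝 ((extChartAt 𝓘(ℝ, E) (1 : G)).symm e * (extChartAt 𝓘(ℝ, E) (1 : G)).symm e *
        ((extChartAt 𝓘(ℝ, E) (1 : G)).symm e)⁻¹)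
    rw [h0]
    exact extChartAt_source_mem_nhds 1
  have hsrc1 : ∀ᶠ p : E × E in 𝓝 (e, e), p.1 ∈ (extChartAt 𝓘(ℝ, E) (1 : G)).target :=
    (continuousAt_fst : ContinuousAt Prod.fst (e, e)).eventually_mem htarget
  obtain ⟨F', h1, h2⟩ := hasFDerivAt_partial_fderiv_conj
    (m := chartMul E G) (k := chartConj E G) (e := e)
    (contDiffAt_infty.1 contDiffAt_chartMul 2)
    (contDiffAt_infty.1 contDiffAt_chartConj 2)
    (by filter_upwards [htarget] with x hx
        simp only [chartMul, hφe, mul_one]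
        exact (extChartAt 𝓘(ℝ, E) (1 : G)).right_inv hx)
    (by filter_upwards [htarget] with x hx
        simp only [chartMul, hφe, one_mul]
        exact (extChartAt 𝓘(ℝ, E) (1 : G)).right_inv hx)
    (by filter_upwards with x
        simp only [chartConj, hφe, mul_one, mul_inv_cancel]; rfl)
    (by filter_upwards [htarget] with x hx
        simp only [chartConj, hφe, one_mul, inv_one, mul_one]
        exact (extChartAt 𝓘(ℝ, E) (1 : G)).right_inv hx)
    (by filter_upwards [hconj, hsrc1] with p hp hp1
        simp only [chartMul, chartConj]
        rw [(extChartAt 𝓘(ℝ, E) (1 : G)).left_inv hp]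
        simp)
    u v
  refine ⟨F', ?_, h2⟩
  exact h1.congr_of_eventuallyEq (Eventually.of_forall fun x =>
    (fderiv_chartConj_eq_adjointAction u).symm)

/-- The curve has velocity `v` at time `0`, so by the chain rule the derivative is the bracket of
`v` and `u`, which vanishes. -/
theorem hasDerivAt_adjointAction_curve {u v : E} (huv : chartBracket E G v u = 0)
    {β : ℝ → G} (hβ0 : β 0 = 1) (hβ : IsMIntegralCurve β (mulInvariantVectorField (I := 𝓘(ℝ, E)) v)) :
    HasDerivAt (fun t => (adjointAction (β t) : E →L[ℝ] E) u) 0 0 := by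
  obtain ⟨F', h1, h2⟩ := exists_hasFDerivAt_adjointAction (E := E) (G := G) u v
  have h3 : HasMFDerivAt 𝓘(ℝ, ℝ) 𝓘(ℝ, E) β 0 ((1 : ℝ →L[ℝ] ℝ).smulRight (v : E)) := by
    have h := hβ 0
    have h0 : (mulInvariantVectorField (I := 𝓘(ℝ, E)) v (β 0) : E) = v := by
      rw [hβ0]; exact mulInvariantVectorField_one_apply v
    exact h0 ▸ h
  have h4 : HasMFDerivAt 𝓘(ℝ, E) 𝓘(ℝ, E) (extChartAt 𝓘(ℝ, E) (1 : G)) (β 0)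
      (ContinuousLinearMap.id ℝ E) := by
    rw [hβ0]
    have h := (mdifferentiableAt_extChartAt (I := 𝓘(ℝ, E)) (x := (1 : G)) (y := 1)
      (by simp)).hasMFDerivAt
    rw [mfderiv_extChartAt_self] at h
    exact h
  set L : ℝ →L[ℝ] E := (ContinuousLinearMap.id ℝ E).comp ((1 : ℝ →L[ℝ] ℝ).smulRight (v : E)) with hL
  have h5 : HasMFDerivAt 𝓘(ℝ, ℝ) 𝓘(ℝ, E) (fun t => extChartAt 𝓘(ℝ, E) (1 : G) (β t)) 0 L :=
    HasMFDerivAt.comp 0 h4 h3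
  have h6 : HasFDerivAt (fun t => extChartAt 𝓘(ℝ, E) (1 : G) (β t)) L 0 :=
    hasMFDerivAt_iff_hasFDerivAt.1 h5
  have h7 := HasFDerivAt.comp (g' := F') (0 : ℝ) (by rw [hβ0]; exact h1) h6
  have h8 := h7.hasDerivAt
  have h9 : (F'.comp L) 1 = 0 := by
    simp [hL, h2, huv]
  rw [h9] at h8
  refine h8.congr_of_eventuallyEq ?_
  have hc : ContinuousAt β 0 := hβ.continuous.continuousAt
  have : ∀ᶠ t in 𝓝 0, β t ∈ (extChartAt 𝓘(ℝ, E) (1 : G)).source :=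
    hc.eventually_mem (by rw [hβ0]; exact extChartAt_source_mem_nhds 1)
  filter_upwards [this] with t ht
  simp only [Function.comp_apply]
  rw [(extChartAt 𝓘(ℝ, E) (1 : G)).left_inv ht]

/-- Left translates of integral curves of a left-invariant vector field are integral curves. -/
theorem IsMIntegralCurveOn.mul_left_mulInvariantVectorField {v : E}
    {β : ℝ → G} {S : Set ℝ}
    (hβ : IsMIntegralCurveOn β (mulInvariantVectorField (I := 𝓘(ℝ, E)) v) S) (g : G) :
    IsMIntegralCurveOn (fun t => g * β t) (mulInvariantVectorField (I := 𝓘(ℝ, E)) v) S := by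
  intro t ht
  have h1 := (mdifferentiableAt_mul_left_model (E := E) g (β t)).hasMFDerivAt
  refine (h1.comp_hasMFDerivWithinAt t (hβ t ht)).congr_mfderiv ?_
  have h2 := modelDeriv_comp (E := E) (f := fun x : G => β t * x) (g := fun x : G => g * x) (x := 1)
    (mdifferentiableAt_mul_left_model _ _) (mdifferentiableAt_mul_left_model _ _) (v : E)
  simp only [← mul_assoc, mul_one] at h2
  refine ContinuousLinearMap.ext fun (r : ℝ) => ?_
  exact (ContinuousLinearMap.map_smul (modelDeriv (fun x : G => g * x) (β t) : E →L[ℝ] E) r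
    ((modelDeriv (fun x : G => β t * x) 1 : E →L[ℝ] E) v)).trans (congrArg (fun z : E => r • z) h2.symm)

theorem IsMIntegralCurve.mul_left_mulInvariantVectorField {v : E}
    {β : ℝ → G} (hβ : IsMIntegralCurve β (mulInvariantVectorField (I := 𝓘(ℝ, E)) v)) (g : G) :
    IsMIntegralCurve (fun t => g * β t) (mulInvariantVectorField (I := 𝓘(ℝ, E)) v) := by
  rw [isMIntegralCurve_iff_isMIntegralCurveOn] at hβ ⊢
  exact hβ.mul_left_mulInvariantVectorField g

theorem contMDiff_mulInvariantVectorField_one (v : E) :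
    ContMDiff 𝓘(ℝ, E) 𝓘(ℝ, E).tangent 1
      (fun g : G => (⟨g, mulInvariantVectorField (I := 𝓘(ℝ, E)) v g⟩ : TangentBundle 𝓘(ℝ, E) G)) := by
  have : LieGroup 𝓘(ℝ, E) (minSmoothness ℝ 3) G := by
    rw [minSmoothness_of_isRCLikeNormedField]
    infer_instance
  exact (contMDiff_mulInvariantVectorField (I := 𝓘(ℝ, E)) v).of_le (by
    simp only [minSmoothness_of_isRCLikeNormedField]; norm_num)

variable [T2Space G]

theorem eq_of_isMIntegralCurve_mulInvariantVectorField {v : E}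
    {β β' : ℝ → G} (hβ : IsMIntegralCurve β (mulInvariantVectorField (I := 𝓘(ℝ, E)) v))
    (hβ' : IsMIntegralCurve β' (mulInvariantVectorField (I := 𝓘(ℝ, E)) v)) (h : β 0 = β' 0) :
    β = β' :=
  isMIntegralCurve_Ioo_eq_of_contMDiff_boundaryless (contMDiff_mulInvariantVectorField_one v)
    hβ hβ' h

/-- Time shifts and left translates of `β` are integral curves of the same field; these two agree at
time `0`, so uniqueness applies. -/
theorem IsMIntegralCurve.add_eq_mul {v : E}
    {β : ℝ → G} (hβ : IsMIntegralCurve β (mulInvariantVectorField (I := 𝓘(ℝ, E)) v))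
    (hβ0 : β 0 = 1) (t h : ℝ) : β (t + h) = β t * β h := by
  have h1 := hβ.comp_add t
  have h2 := hβ.mul_left_mulInvariantVectorField (β t)
  have h3 := eq_of_isMIntegralCurve_mulInvariantVectorField h1 h2 (by simp [hβ0])
  have h4 := congrFun h3 h
  simpa [add_comm] using h4

/-- Left translation carries the local curve at `1` to every point with the same lifetime `ε`; a
uniform lifetime yields a global curve. -/
theorem exists_isMIntegralCurve_mulInvariantVectorField [CompleteSpace E]
    (v : E) :
    ∃ β : ℝ → G, β 0 = 1 ∧ IsMIntegralCurve β (mulInvariantVectorField (I := 𝓘(ℝ, E)) v) := by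
  have hv := contMDiff_mulInvariantVectorField_one (E := E) (G := G) v
  obtain ⟨β, hβ0, hβ⟩ := exists_isMIntegralCurveAt_of_contMDiffAt_boundaryless (t₀ := 0)
    (hv.contMDiffAt (x := (1 : G)))
  rw [isMIntegralCurveAt_iff'] at hβ
  obtain ⟨ε, hε, hβ⟩ := hβ
  rw [Real.ball_eq_Ioo, zero_sub, zero_add] at hβ
  exact exists_isMIntegralCurve_of_isMIntegralCurveOn hv hε (fun x =>
    ⟨fun t => x * β t, by simp [hβ0], hβ.mul_left_mulInvariantVectorField x⟩) 1

/-- The adjoint action of `exp (t v)` fixes `u` if `v` and `u` commute. -/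
theorem adjointAction_curve_eq {u v : E} (huv : chartBracket E G v u = 0)
    {β : ℝ → G} (hβ0 : β 0 = 1) (hβ : IsMIntegralCurve β (mulInvariantVectorField (I := 𝓘(ℝ, E)) v))
    (t : ℝ) : (adjointAction (β t) : E →L[ℝ] E) u = u := by
  -- The factorization `Ad (β h) = Ad (β t) ∘ Ad (β (h - t))` reduces the derivative at `t` to the
  -- one at `0`.
  have hd : ∀ t, HasDerivAt (fun t => (adjointAction (β t) : E →L[ℝ] E) u) 0 t := by
    intro t
    have h0 := hasDerivAt_adjointAction_curve huv hβ0 hβ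
    have h1 : HasDerivAt (fun h => (adjointAction (β t) : E →L[ℝ] E)
        ((adjointAction (β (h - t)) : E →L[ℝ] E) u)) ((adjointAction (β t) : E →L[ℝ] E) 0) t := by
      refine HasFDerivAt.comp_hasDerivAt (E := E) (F := E) t
        (ContinuousLinearMap.hasFDerivAt (adjointAction (β t) : E →L[ℝ] E)) ?_
      refine HasDerivAt.comp_sub_const (f := fun h => (adjointAction (β h) : E →L[ℝ] E) u) t t ?_
      rwa [sub_self]
    rw [map_zero] at h1
    refine h1.congr_of_eventuallyEq (Eventually.of_forall fun h => ?_)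
    simp only
    rw [← adjointAction_mul, ← hβ.add_eq_mul hβ0, add_sub_cancel]
  have hconst := is_const_of_deriv_eq_zero (fun t => (hd t).differentiableAt)
    (fun t => (hd t).deriv) t 0
  simpa only [hβ0, adjointAction_one] using hconst

/-- The product of commuting one-parameter subgroups is a one-parameter subgroup. -/
theorem IsMIntegralCurve.mul_of_lie_eq_zero {u v : E} (huv : chartBracket E G v u = 0)
    {α β : ℝ → G} (hα : IsMIntegralCurve α (mulInvariantVectorField (I := 𝓘(ℝ, E)) u))
    (hβ0 : β 0 = 1) (hβ : IsMIntegralCurve β (mulInvariantVectorField (I := 𝓘(ℝ, E)) v)) :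
    IsMIntegralCurve (fun t => α t * β t) (mulInvariantVectorField (I := 𝓘(ℝ, E)) (u + v)) := by
  intro t
  set a := α t with ha
  set b := β t with hb
  have h1 : HasMFDerivAt 𝓘(ℝ, ℝ) (𝓘(ℝ, E).prod 𝓘(ℝ, E)) (fun t => (α t, β t)) t _ :=
    (hα t).prodMk (hβ t)
  have hmd : MDifferentiableAt (𝓘(ℝ, E).prod 𝓘(ℝ, E)) 𝓘(ℝ, E) (fun p : G × G => p.1 * p.2)
      (a, b) := (contMDiff_mul 𝓘(ℝ, E) ∞).mdifferentiableAt (by simp)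
  have h2 := HasMFDerivAt.comp (g := fun p : G × G => p.1 * p.2) t hmd.hasMFDerivAt h1
  refine h2.congr_mfderiv ?_
  refine ContinuousLinearMap.ext fun (r : ℝ) => ?_
  have h3 := mfderiv_prod_eq_add_apply
    (v := (r • (modelDeriv (fun x : G => a * x) 1 : E →L[ℝ] E) u,
      r • (modelDeriv (fun x : G => b * x) 1 : E →L[ℝ] E) v)) hmd
  refine Eq.trans h3 ?_
  -- Since `a (b x b⁻¹) b = a b x` and `Ad b` fixes `u`, right translation by `b` acts here like a
  -- left one.
  have e1 : (modelDeriv (fun x : G => x * b) a : E →L[ℝ] E)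
      ((modelDeriv (fun x : G => a * x) 1 : E →L[ℝ] E) u) =
      (modelDeriv (fun x : G => a * b * x) 1 : E →L[ℝ] E) u := by
    have c1 := modelDeriv_comp (E := E) (f := fun x : G => a * x) (g := fun x : G => x * b) (x := 1)
      (mdifferentiableAt_mul_right_model _ _) (mdifferentiableAt_mul_left_model _ _) u
    have c2 := modelDeriv_comp (E := E) (f := fun x : G => b * x * b⁻¹)
      (g := fun x : G => a * x * b) (x := 1)
      (mdifferentiableAt_mul_mul _ _ _) (mdifferentiableAt_mul_mul _ _ _) u
    have c3 : (fun y : G => a * (b * y * b⁻¹) * b) = fun y => a * b * y := by ext y; group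
    have c4 : (modelDeriv (fun x : G => b * x * b⁻¹) 1 : E →L[ℝ] E) u = u :=
      adjointAction_curve_eq huv hβ0 hβ t
    rw [c3, c4] at c2
    simp only [mul_one, mul_inv_cancel] at c1 c2
    exact c1.symm.trans c2.symm
  have e2 : (modelDeriv (fun x : G => a * x) b : E →L[ℝ] E)
      ((modelDeriv (fun x : G => b * x) 1 : E →L[ℝ] E) v) =
      (modelDeriv (fun x : G => a * b * x) 1 : E →L[ℝ] E) v := by
    have c1 := modelDeriv_comp (E := E) (f := fun x : G => b * x) (g := fun x : G => a * x) (x := 1)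
      (mdifferentiableAt_mul_left_model _ _) (mdifferentiableAt_mul_left_model _ _) v
    simp only [← mul_assoc, mul_one] at c1
    exact c1.symm
  have e3 : ∀ (A B C : E →L[ℝ] E) (x y : E), A x = C u → B y = C v →
      A (r • x) + B (r • y) = r • C (u + v) := by
    intro A B C x y hA hB
    rw [map_smul, map_smul, hA, hB, map_add, smul_add]
  exact e3 _ _ _ _ _ e1 e2

theorem lieExp_eq {v : GroupLieAlgebra 𝓘(ℝ, E) G} {β : ℝ → G} (hβ0 : β 0 = 1)
    (hβ : IsMIntegralCurve β (mulInvariantVectorField v)) :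
    lieExp v = β 1 := by
  have h : ∃ γ : ℝ → G, γ 0 = 1 ∧
      IsMIntegralCurve (I := 𝓘(ℝ, E)) γ (mulInvariantVectorField v) := ⟨β, hβ0, hβ⟩
  rw [lieExp, dif_pos h]
  exact congrFun (eq_of_isMIntegralCurve_mulInvariantVectorField h.choose_spec.2 hβ
    (h.choose_spec.1.trans hβ0.symm)) 1

theorem lieExp_add [CompleteSpace E] {u v : GroupLieAlgebra 𝓘(ℝ, E) G} (huv : ⁅v, u⁆ = 0) :
    lieExp (u + v) = lieExp u * lieExp v := by
  have huv' : chartBracket E G v u = 0 := (lie_eq_chartBracket v u).symm.trans huv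
  obtain ⟨a, ha0, ha⟩ := exists_isMIntegralCurve_mulInvariantVectorField (E := E) (G := G) u
  obtain ⟨b, hb0, hb⟩ := exists_isMIntegralCurve_mulInvariantVectorField (E := E) (G := G) v
  rw [lieExp_eq ha0 ha, lieExp_eq hb0 hb]
  exact lieExp_eq (β := fun t => a t * b t) (by simp [ha0, hb0])
    (ha.mul_of_lie_eq_zero huv' hb0 hb)

theorem lieExp_zero : lieExp (0 : GroupLieAlgebra 𝓘(ℝ, E) G) = 1 := by
  refine lieExp_eq (β := fun _ => 1) rfl (isMIntegralCurve_const ?_)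
  exact mulInvariantVectorField_one_apply 0

end LieGroupExponential

/-! ### From an abelian homogeneous plane to the failure of BCP. -/

/-- BCP fails for a left-invariant quasi-distance whose unit ball cuts a homogeneous abelian
plane, with dilations `(l x, l ^ s y)`, in `{a |x| ^ g + b |y| ^ h ≤ 1}` with `g < s`. -/
theorem not_satisfiesBCP_of_plane {G : Type*} [Group G] {d : G → G → ℝ} (hd : IsQuasiDist d)
    (hinv : ∀ p q q' : G, d (p * q) (p * q') = d q q') {P : ℝ → ℝ → G}
    (hPmul : ∀ x y x' y', P x y * P x' y' = P (x + x') (y + y')) {s : ℕ} (hs : 1 ≤ s)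
    (hdil : ∀ r, 0 < r → ∀ x y, d (P (r * x) (r ^ s * y)) 1 = r * d (P x y) 1)
    {a b g h : ℝ} (ha : 0 < a) (hb : 0 < b) (hg : 0 < g) (hh : 0 < h) (hgs : g < s)
    (hball : ∀ x y, d (P x y) 1 ≤ 1 ↔ a * |x| ^ g + b * |y| ^ h ≤ 1) : ¬ SatisfiesBCP d := by
  have hPd : ∀ x y x' y', d (P x y) (P x' y') = d (P (x - x') (y - y')) 1 := by
    intro x y x' y'
    rw [← hinv (P x' y') _ 1, hPmul, mul_one]
    simp
  have hscale : ∀ r, 0 < r → ∀ x y, d (P x y) 1 ≤ r ↔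
      a * |x / r| ^ g + b * |y / r ^ s| ^ h ≤ 1 := by
    intro r hr x y
    have h1 := hdil r hr (x / r) (y / r ^ s)
    rw [mul_div_cancel₀ _ hr.ne', mul_div_cancel₀ _ (pow_pos hr s).ne'] at h1
    rw [h1, ← hball]
    exact mul_le_iff_le_one_right hr
  obtain ⟨f, hf1, hf2⟩ := exists_seq_gauge ha hb hg hh hs hgs
  have hfar : ∀ m n, m < n →
      (f n).1 < d (P (f m).2.1 (f m).2.2) (P (f n).2.1 (f n).2.2) := by
    intro m n hmn
    rw [hd.symm, hPd, ← not_le, hscale _ (hf1 n).1, not_le]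
    exact (hf2 m n hmn).2
  refine not_satisfiesBCP_of_seq (fun p => (hd.eq_zero_iff p p).2 rfl)
    (p := fun n => P (f n).2.1 (f n).2.2) (r := fun n => (f n).1) (fun n => (hf1 n).1) (x := 1)
    (fun n => ?_) (fun m n hmn => ?_)
  · rw [hd.symm, hscale _ (hf1 n).1]
    exact (hf1 n).2.2
  · obtain h | h := hmn.lt_or_gt
    · exact hfar m n h
    -- Radii are nondecreasing, so separation by the radius of the later ball also exceeds that of
    -- the earlier one.
    · rw [hd.symm]
      exact (hf2 n m h).1.trans_lt (hfar n m h)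

/-! ### The commuting plane inside a Carnot group. -/

section CarnotPlane

variable {E : Type*} [NormedAddCommGroup E] [NormedSpace ℝ E]
  {G : Type*} [TopologicalSpace G] [ChartedSpace E G] [Group G]

/-- An adapted basis has an element in the last layer. -/
theorem IsAdaptedBasis.exists_eq_step {s : ℕ}
    {V : ℕ → Submodule ℝ (GroupLieAlgebra 𝓘(ℝ, E) G)} (hV : IsStratification s V) {n : ℕ}
    {X : Module.Basis (Fin n) ℝ (GroupLieAlgebra 𝓘(ℝ, E) G)} {α : Fin n → ℕ}
    (hX : IsAdaptedBasis s V X α) : ∃ i, α i = s := by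
  by_contra! h
  have hs := hV.one_le_step
  have hind := hV.isInternal.submodule_iSupIndep ⟨s - 1, by omega⟩
  -- With no basis vector in `V s`, the other layers would span everything, and independence would
  -- force `V s = ⊥`.
  have htop : (⨆ (j : Fin s) (_ : j ≠ ⟨s - 1, by omega⟩), V ((j : ℕ) + 1)) = ⊤ := by
    rw [eq_top_iff, ← X.span_eq, Submodule.span_le]
    rintro _ ⟨i, rfl⟩
    obtain ⟨h1, h2⟩ := hX.mem_Icc i
    have h3 := h i
    have h4 : V (α i) ≤ ⨆ (j : Fin s) (_ : j ≠ ⟨s - 1, by omega⟩), V ((j : ℕ) + 1) := by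
      refine le_iSup₂_of_le ⟨α i - 1, by omega⟩ ?_ ?_
      · simp only [ne_eq, Fin.mk.injEq]; omega
      · simp only [Nat.sub_add_cancel h1, le_refl]
    exact h4 (hX.mem_layer i)
  rw [htop, disjoint_top] at hind
  simp only [Nat.sub_add_cancel hs] at hind
  exact hV.last_ne_bot hind

/-- A basis vector of the first layer commutes with another one of the last layer. -/
theorem IsAdaptedBasis.exists_lie_eq_zero {s : ℕ}
    {V : ℕ → Submodule ℝ (GroupLieAlgebra 𝓘(ℝ, E) G)} (hV : IsStratification s V) {n : ℕ}
    (hn : 2 ≤ n) {X : Module.Basis (Fin n) ℝ (GroupLieAlgebra 𝓘(ℝ, E) G)} {α : Fin n → ℕ}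
    (hX : IsAdaptedBasis s V X α) {k : Fin n} (hk : α k = 1) :
    ∃ l, l ≠ k ∧ α l = s ∧ ⁅X k, X l⁆ = 0 := by
  have hlie : ∀ l, α l = s → ⁅X k, X l⁆ = 0 := by
    intro l hl
    have hmem : ⁅X k, X l⁆ ∈ bracketSpan (V 1) (V s) :=
      Submodule.subset_span ⟨X k, hk ▸ hX.mem_layer k, X l, hl ▸ hX.mem_layer l, rfl⟩
    rwa [hV.bracket_last, Submodule.mem_bot] at hmem
  obtain hs | hs := hV.one_le_step.eq_or_lt
  -- In step one every basis vector lies in the last layer, and `n ≥ 2` supplies one different from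
  -- `X k`.
  · have : Nontrivial (Fin n) := Fin.nontrivial_iff_two_le.2 hn
    obtain ⟨l, hl⟩ := exists_ne k
    have hαl : α l = s := by
      obtain ⟨h1, h2⟩ := hX.mem_Icc l
      omega
    exact ⟨l, hl, hαl, hlie l hαl⟩
  · obtain ⟨l, hl⟩ := hX.exists_eq_step hV
    refine ⟨l, ?_, hl, hlie l hl⟩
    rintro rfl
    omega

theorem expPoint_single_add_single {n : ℕ}
    (X : Module.Basis (Fin n) ℝ (GroupLieAlgebra 𝓘(ℝ, E) G)) (k l : Fin n) (x y : ℝ) :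
    expPoint X (Pi.single k x + Pi.single l y) = lieExp (x • X k + y • X l) := by
  simp [expPoint, add_smul, Finset.sum_add_distrib, Pi.single_apply, ite_smul]

/-- Positivity of the exponents matters: `0 ^ 0 = 1` would make the other coordinates contribute. -/
theorem sum_gauge_single_add_single {n : ℕ} {c γ : Fin n → ℝ} (hγ : ∀ i, 0 < γ i) {k l : Fin n}
    (hkl : l ≠ k) (x y : ℝ) :
    ∑ i, c i * |(Pi.single k x + Pi.single l y : Fin n → ℝ) i| ^ γ i =
      c k * |x| ^ γ k + c l * |y| ^ γ l := by
  rw [← Finset.sum_subset (Finset.subset_univ {k, l}) (fun i _ hi => ?_),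
    Finset.sum_pair hkl.symm]
  · simp [hkl, hkl.symm]
  · simp only [Finset.mem_insert, Finset.mem_singleton, not_or] at hi
    simp [hi.1, hi.2, Real.zero_rpow (hγ i).ne']

theorem coordDilation_single_add_single {n : ℕ} (α : Fin n → ℕ) (k l : Fin n) (r x y : ℝ) :
    coordDilation α r (Pi.single k x + Pi.single l y) =
      Pi.single k (r ^ α k * x) + Pi.single l (r ^ α l * y) := by
  ext i
  simp only [coordDilation, Pi.add_apply, mul_add, Pi.single_apply]
  split_ifs <;> simp_all

/-- Exponential coordinates are additive on the plane spanned by two commuting basis vectors. -/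
theorem expPoint_mul_of_lie_eq_zero [CompleteSpace E] [T2Space G] [LieGroup 𝓘(ℝ, E) ∞ G] {n : ℕ}
    (X : Module.Basis (Fin n) ℝ (GroupLieAlgebra 𝓘(ℝ, E) G)) {k l : Fin n}
    (hlie : ⁅X k, X l⁆ = 0) (x y x' y' : ℝ) :
    expPoint X (Pi.single k x + Pi.single l y) * expPoint X (Pi.single k x' + Pi.single l y') =
      expPoint X (Pi.single k (x + x') + Pi.single l (y + y')) := by
  have : LieGroup 𝓘(ℝ, E) (minSmoothness ℝ 3) G := by
    rw [minSmoothness_of_isRCLikeNormedField]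
    infer_instance
  have hlie' : ⁅X l, X k⁆ = 0 := by rw [← lie_skew, hlie, neg_zero]
  have hcomm : ⁅x' • X k + y' • X l, x • X k + y • X l⁆ = 0 := by
    simp only [add_lie, lie_add, smul_lie, lie_smul, lie_self, hlie, hlie', smul_zero, add_zero]
  simp only [expPoint_single_add_single]
  rw [← lieExp_add hcomm]
  congr 1
  rw [add_smul, add_smul]
  abel

theorem expPoint_zero [T2Space G] [LieGroup 𝓘(ℝ, E) ∞ G] {n : ℕ}
    (X : Module.Basis (Fin n) ℝ (GroupLieAlgebra 𝓘(ℝ, E) G)) : expPoint X 0 = 1 := by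
  simp only [expPoint, Pi.zero_apply, zero_smul, Finset.sum_const_zero]
  exact lieExp_zero

end CarnotPlane

/-- `G` is a Carnot group of step `s` and topological dimension `n ≥ 2`, and `d` is the homogeneous
quasi-distance whose unit ball centered at the origin is `{∑ cᵢ |xᵢ| ^ γᵢ ≤ 1}` in exponential
coordinates. If BCP holds, all the exponents attached to the first layer are at least `s`. -/
theorem lemma3p1
    {E : Type*} [NormedAddCommGroup E] [NormedSpace ℝ E] [FiniteDimensional ℝ E]
    {G : Type*} [TopologicalSpace G] [T2Space G] [ConnectedSpace G] [SimplyConnectedSpace G]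
    [ChartedSpace E G] [Group G] [LieGroup 𝓘(ℝ, E) ∞ G]
    (s : ℕ) (V : ℕ → Submodule ℝ (GroupLieAlgebra 𝓘(ℝ, E) G)) (hV : IsStratification s V)
    (n : ℕ) (hn : 2 ≤ n)
    (X : Module.Basis (Fin n) ℝ (GroupLieAlgebra 𝓘(ℝ, E) G)) (α : Fin n → ℕ)
    (hX : IsAdaptedBasis s V X α)
    (c γ : Fin n → ℝ) (hc : ∀ i, 0 < c i) (hγ : ∀ i, 0 < γ i)
    (d : G → G → ℝ) (hd : IsHomogeneousQuasiDist X α d)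
    (hball : expPoint X ⁻¹' qBall d 1 1 = {x : Fin n → ℝ | ∑ i, c i * |x i| ^ γ i ≤ 1})
    (hBCP : SatisfiesBCP d) :
    ∀ i : Fin n, α i = 1 → (s : ℝ) ≤ γ i := by
  intro k hk
  by_contra! hlt
  obtain ⟨l, hlk, hl, hlie⟩ := hX.exists_lie_eq_zero hV hn hk
  have : CompleteSpace E := FiniteDimensional.complete ℝ E
  have hdil : ∀ r : ℝ, 0 < r → ∀ x y : ℝ,
      d (expPoint X (Pi.single k (r * x) + Pi.single l (r ^ s * y))) 1 =
        r * d (expPoint X (Pi.single k x + Pi.single l y)) 1 := by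
    intro r hr x y
    have h := hd.one_homogeneous r hr (Pi.single k x + Pi.single l y) 0
    have h0 : coordDilation α r 0 = 0 := by ext i; simp [coordDilation]
    rwa [coordDilation_single_add_single, hk, hl, pow_one, h0, expPoint_zero] at h
  have hunit : ∀ x y : ℝ, d (expPoint X (Pi.single k x + Pi.single l y)) 1 ≤ 1 ↔
      c k * |x| ^ γ k + c l * |y| ^ γ l ≤ 1 := by
    intro x y
    have h := Set.ext_iff.1 hball (Pi.single k x + Pi.single l y)
    rw [Set.mem_ofPred_eq, sum_gauge_single_add_single hγ hlk] at h
    rw [← h]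
    rfl
  have hmul : ∀ x y x' y' : ℝ, expPoint X (Pi.single k x + Pi.single l y) *
      expPoint X (Pi.single k x' + Pi.single l y') =
      expPoint X (Pi.single k (x + x') + Pi.single l (y + y')) :=
    expPoint_mul_of_lie_eq_zero X hlie
  -- From here on, the coordinates enter only through dilations, the unit ball and additivity on the
  -- plane.
  generalize expPoint X = Q at hdil hunit hmul
  exact not_satisfiesBCP_of_plane hd.isQuasiDist hd.left_invariant
    (P := fun x y => Q (Pi.single k x + Pi.single l y))
    hmul hV.one_le_step hdil (hc k) (hc l) (hγ k) (hγ l) hlt hunit hBCP
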